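/- For a finite set $Q\subset\mathbb{R}^d$ and a direction $u\in\mathbb{R}^d$ let $\omega(Q,u)=\max_{q\in Q}\langle u,q\rangle+\max_{q\in Q}\langle -u,q\rangle$ be the directional width, with $\omega(\emptyset,u)=0$. A collection $\mathcal{P}$ of stochastic points (existential uncertainty model) consists of finitely many points $v\in\mathbb{R}^d$, possibly co-located, each present independently with its existential probability $p_v\in[0,1]$; $\Pr[\omega(\mathcal{P},u)\le t]$ denotes the probability that the set of present points has width at most $t$ in direction $u$. Let $\mathcal{P}$ be a nonempty such collection with $0<p_v<1$ for all $v$, and put $\lambda_v=-\ln(1-p_v)$ and $\lambda=\sum_{v}\lambda_v$. For $N\ge 1$ the Poissonized sampling algorithm draws $N$ independent samples from the probability measure that gives $v$ the mass $\lambda_v/\lambda$; the coreset $\mathcal{S}$ consists of the $N$ sampled points (with repetition), each present independently with the same existential probability $1-e^{-\lambda/N}$. Theorem. For every $d$ there is a constant $C>0$ (depending only on $d$) such that for every nonempty collection $\mathcal{P}$ of stochastic points in $\mathbb{R}^d$ with $0<p_v<1$ for all $v$, all $0<\tau\le\frac12$ and $0<\delta\le\frac12$, and every integer $N\ge C\,\frac{\lambda^4}{\tau^4}\ln\frac1\delta$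 (in particular for $N=\lceil C\,\frac{\lambda^4}{\tau^4}\ln\frac1\delta\rceil$), the following holds: with probability at least $1-\delta$ over the choice of the samples, for all $t\ge 0$ and all directions $u\in\mathbb{R}^d$ simultaneously, $$\bigl|\Pr[\omega(\mathcal{S},u)\le t]-\Pr[\omega(\mathcal{P},u)\le t]\bigr|\le\tau .$$ -/

import Mathlib

open MeasureTheory ProbabilityTheory

noncomputable section

/-- The space `ℝ^d` with the Euclidean inner product. -/
abbrev Pt (d : ℕ) : Type := EuclideanSpace ℝ (Fin d)

/-- The support function `max_{p ∈ P} ⟨u, p⟩` of a nonempty finite set of deterministic points. -/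
def supportFn {d : ℕ} (P : Finset (Pt d)) (hP : P.Nonempty) (u : Pt d) : ℝ :=
  P.sup' hP fun p => inner ℝ u p

/-- The directional width `f(P, u) + f(P, -u)` of a finite set of deterministic points.
The width of the empty set is `0`. -/
def dirWidth {d : ℕ} (P : Finset (Pt d)) (u : Pt d) : ℝ :=
  if hP : P.Nonempty then supportFn P hP u + supportFn P hP (-u) else 0

/-- A collection of `n` stochastic points of `ℝ^d` in the existential uncertainty model: the
`i`-th point is located at `pos i` and is present, independently of the other points, with
probability `prob i`. Points may be co-located. -/
structure StochasticPoints (d n : ℕ) where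
  pos : Fin n → Pt d
  prob : Fin n → unitInterval

namespace StochasticPoints

variable {d n : ℕ}

/-- The law of the presence indicators: independent Bernoulli variables. -/
def presenceLaw (P : StochasticPoints d n) : Measure (Fin n → Bool) :=
  Measure.pi fun i => bernoulliMeasure true false (P.prob i)

open Classical in
/-- The realized set of points, given which points are present. -/
def realization (P : StochasticPoints d n) (present : Fin n → Bool) : Finset (Pt d) :=
  (Finset.univ.filter fun i => present i = true).image P.pos

/-- The cumulative distribution function of the directional width in direction `u`:
the probability that the width of a random realization is at most `t`. -/
def widthCDF (P : StochasticPoints d n) (u : Pt d) (t : ℝ) : ℝ :=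
  P.presenceLaw.real {present | dirWidth (P.realization present) u ≤ t}

/-- The Poisson rate `λ_v = -ln (1 - p_v)` of the `i`-th point. -/
def rate (P : StochasticPoints d n) (i : Fin n) : ℝ :=
  -Real.log (1 - (P.prob i : ℝ))

/-- The total rate `λ = ∑ λ_v`. -/
def totalRate (P : StochasticPoints d n) : ℝ :=
  ∑ i, P.rate i

/-- The measure on (the indices of) the points that gives the point `v` the mass `λ_v / λ`. -/
def rateMeasure (P : StochasticPoints d n) : Measure (Fin n) :=
  ∑ i, ENNReal.ofReal (P.rate i / P.totalRate) • Measure.dirac i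

/-- The law of `N` independent samples from `rateMeasure`. -/
def sampleLaw (P : StochasticPoints d n) (N : ℕ) : Measure (Fin N → Fin n) :=
  Measure.pi fun _ => P.rateMeasure

lemma rate_nonneg (P : StochasticPoints d n) (i : Fin n) : 0 ≤ P.rate i := by
  have h0 := (P.prob i).2.1
  have h1 := (P.prob i).2.2
  exact neg_nonneg.mpr (Real.log_nonpos (by linarith) (by linarith))

lemma totalRate_nonneg (P : StochasticPoints d n) : 0 ≤ P.totalRate :=
  Finset.sum_nonneg fun i _ => P.rate_nonneg i

lemma coreset_prob_mem (P : StochasticPoints d n) (N : ℕ) :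
    1 - Real.exp (-(P.totalRate / N)) ∈ unitInterval := by
  have h : 0 ≤ P.totalRate / N := div_nonneg P.totalRate_nonneg (Nat.cast_nonneg N)
  have h1 : Real.exp (-(P.totalRate / N)) ≤ 1 := Real.exp_le_one_iff.mpr (by linarith)
  have h2 := Real.exp_pos (-(P.totalRate / N))
  exact ⟨by linarith, by linarith⟩

/-- The coreset obtained from a sample: the `N` sampled points, each with the same existential
probability `1 - exp (-λ / N)`. -/
def coreset (P : StochasticPoints d n) {N : ℕ} (sample : Fin N → Fin n) :
    StochasticPoints d N where
  pos k := P.pos (sample k)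
  prob _ := ⟨1 - Real.exp (-(P.totalRate / N)), P.coreset_prob_mem N⟩

end StochasticPoints

end

/-! Give a point of rate `r` the presence probability `1 - exp (-r)`. Then `P` and the coreset live
on one index set, points plus samples, with rates `(λ_v, 0)` and `(0, λ/N)`. Interpolate linearly
between these rates. The derivative of an expectation `E F` is the expectation, under the
interpolated law, of `∑ ρ i * (F (b ∪ {i}) - F b)`, where `ρ` is the difference of the rates
(`hasDerivAt_presenceExp`).

Let `F` indicate that the width is at most `t`. Since `∑ ρ i = 0`, only `∑ ρ i * F (b ∪ {i})`
remains. If `b` is already too wide it vanishes; otherwise the admissible `i` are those whose point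
lies in a slab (`exists_spreadInd_update_eq`), and the sum is `λ` times the sampling error of that
slab. So it suffices that the sample approximates all slabs up to `ε = τ / λ`, uniformly in `u`, `t`
and `b`.

This is a Vapnik–Chervonenkis bound: Radon and Sauer–Shelah give polynomially many traces, and
symmetrization with a ghost sample gives failure probability at most `2 (2N+1)^(2(d+1)) exp (-N ε² /
2)`. The fourth power of `λ / τ` lets the crude estimate `log (2N+1) ≤ 2 √N` absorb the polynomial
factor. -/

/-- The probability that a point of Poisson rate `r` is present (`true`) or absent (`false`). -/
noncomputable def presenceWeight (r : ℝ) (b : Bool) : ℝ :=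
  bif b then 1 - Real.exp (-r) else Real.exp (-r)

/-- The expectation of `F` over independent presence indicators with rates `r`. -/
noncomputable def presenceExp {ι : Type*} [Fintype ι] [DecidableEq ι] (r : ι → ℝ)
    (F : (ι → Bool) → ℝ) : ℝ :=
  ∑ b, (∏ i, presenceWeight (r i) (b i)) * F b

/-! ### Differentiation of expectations in the rates -/

section PresenceExp

variable {ι : Type*} [Fintype ι] [DecidableEq ι]

lemma presenceWeight_nonneg {r : ℝ} (hr : 0 ≤ r) (b : Bool) : 0 ≤ presenceWeight r b := by
  have := Real.exp_le_one_iff.mpr (neg_nonpos.mpr hr)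
  have := Real.exp_pos (-r)
  cases b <;> simp [presenceWeight] <;> linarith

lemma sum_presenceWeight (r : ι → ℝ) : ∑ b : ι → Bool, ∏ i, presenceWeight (r i) (b i) = 1 := by
  have h := Finset.prod_univ_sum (fun _ : ι => (Finset.univ : Finset Bool))
    (fun i b => presenceWeight (r i) b)
  rw [Fintype.piFinset_univ] at h
  rw [← h]
  simp [presenceWeight]

lemma abs_presenceExp_le {r : ι → ℝ} (hr : ∀ i, 0 ≤ r i) {F : (ι → Bool) → ℝ} {K : ℝ}
    (hF : ∀ b, |F b| ≤ K) : |presenceExp r F| ≤ K := by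
  have hw : ∀ b : ι → Bool, 0 ≤ ∏ i, presenceWeight (r i) (b i) := fun b =>
    Finset.prod_nonneg fun i _ => presenceWeight_nonneg (hr i) _
  calc |presenceExp r F| ≤ ∑ b, |(∏ i, presenceWeight (r i) (b i)) * F b| :=
        Finset.abs_sum_le_sum_abs _ _
    _ ≤ ∑ b : ι → Bool, (∏ i, presenceWeight (r i) (b i)) * K := by
        refine Finset.sum_le_sum fun b _ => ?_
        rw [abs_mul, abs_of_nonneg (hw b)]
        exact mul_le_mul_of_nonneg_left (hF b) (hw b)
    _ = K := by rw [← Finset.sum_mul, sum_presenceWeight, one_mul]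

lemma hasDerivAt_presenceWeight (a ρ s : ℝ) (b : Bool) :
    HasDerivAt (fun s => presenceWeight (a + s * ρ) b)
      (ρ * (Real.exp (-(a + s * ρ)) * (bif b then 1 else -1))) s := by
  have h : HasDerivAt (fun s => Real.exp (-(a + s * ρ))) (Real.exp (-(a + s * ρ)) * (-ρ)) s := by
    have := (((hasDerivAt_id s).mul_const ρ).const_add a).neg.exp
    simpa using this
  cases b
  · simpa [presenceWeight, mul_comm] using h
  · simpa [presenceWeight, mul_comm] using h.const_sub 1

lemma sum_flip (i : ι) (K : (ι → Bool) → ℝ) :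
    ∑ b, K (Function.update b i (!b i)) = ∑ b, K b := by
  have h : Function.Involutive fun b : ι → Bool => Function.update b i (!b i) := by
    intro b
    ext j
    by_cases hj : j = i
    · subst hj; simp
    · simp [hj]
  exact Equiv.sum_comp h.toPerm K

/-- Pair each `b` with its flip at `i`. The factor `exp (-r i)` from differentiating either weight
is the probability that `i` is absent, while on the right the terms with `i` present vanish. Hence
the derivative is again an expectation under the same law. -/
lemma sum_presence_deriv (r : ι → ℝ) (F : (ι → Bool) → ℝ) (i : ι) :
    ∑ b : ι → Bool, (∏ j ∈ Finset.univ.erase i, presenceWeight (r j) (b j)) *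
        (Real.exp (-r i) * (bif b i then 1 else -1)) * F b =
      ∑ b : ι → Bool, (∏ j, presenceWeight (r j) (b j)) *
        (F (Function.update b i true) - F b) := by
  have key : ∀ K K' : (ι → Bool) → ℝ,
      (∀ b, K b + K (Function.update b i (!b i)) = K' b + K' (Function.update b i (!b i))) →
      ∑ b, K b = ∑ b, K' b := by
    intro K K' h
    have h2 := Finset.sum_congr (rfl : (Finset.univ : Finset (ι → Bool)) = _) fun b _ => h b
    rw [Finset.sum_add_distrib, Finset.sum_add_distrib, sum_flip, sum_flip] at h2
    linarith
  apply key
  intro b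
  have hprod : ∀ c : Bool, ∏ j ∈ Finset.univ.erase i,
      presenceWeight (r j) (Function.update b i c j) =
      ∏ j ∈ Finset.univ.erase i, presenceWeight (r j) (b j) := fun c =>
    Finset.prod_congr rfl fun j hj => by simp [Finset.ne_of_mem_erase hj]
  simp only [← Finset.mul_prod_erase Finset.univ _ (Finset.mem_univ i), hprod,
    Function.update_self, Function.update_idem]
  cases hb : b i
  · have : Function.update b i false = b := by rw [← hb, Function.update_eq_self]
    simp [presenceWeight]
    ring
  · have : Function.update b i true = b := by rw [← hb, Function.update_eq_self]
    simp [presenceWeight, this]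
    ring

lemma hasDerivAt_presenceExp (r ρ : ι → ℝ) (F : (ι → Bool) → ℝ) (s : ℝ) :
    HasDerivAt (fun s => presenceExp (fun i => r i + s * ρ i) F)
      (presenceExp (fun i => r i + s * ρ i)
        fun b => ∑ i, ρ i * (F (Function.update b i true) - F b)) s := by
  have h : HasDerivAt (fun s => presenceExp (fun i => r i + s * ρ i) F)
      (∑ b : ι → Bool, (∑ i, (∏ j ∈ Finset.univ.erase i, presenceWeight (r j + s * ρ j) (b j)) •
        (ρ i * (Real.exp (-(r i + s * ρ i)) * (bif b i then 1 else -1)))) * F b) s :=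
    HasDerivAt.fun_sum fun b _ =>
      (HasDerivAt.fun_finsetProd fun i _ => hasDerivAt_presenceWeight (r i) (ρ i) s (b i)).mul_const
        (F b)
  convert h using 1
  simp only [presenceExp, Finset.mul_sum, Finset.sum_mul, smul_eq_mul]
  rw [Finset.sum_comm]
  conv_rhs => rw [Finset.sum_comm]
  refine Finset.sum_congr rfl fun i _ => ?_
  have := congrArg (fun y => ρ i * y) (sum_presence_deriv (fun i => r i + s * ρ i) F i)
  simp only [Finset.mul_sum] at this
  exact (Finset.sum_congr rfl fun b _ => by ring).trans
    (this.symm.trans (Finset.sum_congr rfl fun b _ => by ring))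

/-- Moving the rates along `ρ` changes the expectation of `F` by at most the largest value
of the generator `∑ i, ρ i * (F (b ∪ {i}) - F b)`. -/
lemma abs_presenceExp_sub_le (r ρ : ι → ℝ) (h0 : ∀ i, 0 ≤ r i) (h1 : ∀ i, 0 ≤ r i + ρ i)
    (F : (ι → Bool) → ℝ) {K : ℝ}
    (hF : ∀ b, |∑ i, ρ i * (F (Function.update b i true) - F b)| ≤ K) :
    |presenceExp (fun i => r i + ρ i) F - presenceExp r F| ≤ K := by
  have := norm_image_sub_le_of_norm_deriv_le_segment_01' (C := K)
    (fun s _ => (hasDerivAt_presenceExp r ρ F s).hasDerivWithinAt)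
    -- The intermediate rates are the convex combinations `(1 - s) * r i + s * (r i + ρ i)`, hence
    -- nonnegative.
    (fun s hs => abs_presenceExp_le (fun i => by
      nlinarith [h0 i, h1 i, hs.1, hs.2, mul_nonneg hs.1 (h1 i),
        mul_nonneg (sub_nonneg.2 hs.2.le) (h0 i)]) hF)
  simpa using this

end PresenceExp

/-! ### Uniform law of large numbers by symmetrization -/

/-- The sets cut out of `Y` by the members of `𝓡`. -/
def traces {α : Type*} [DecidableEq α] (𝓡 : Finset (Finset α)) (Y : Finset α) :
    Finset (Finset α) :=
  𝓡.image fun R => Y ∩ R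

/-- The real-valued indicator of a finite set. -/
def finInd {α : Type*} [DecidableEq α] (T : Finset α) (a : α) : ℝ :=
  if a ∈ T then 1 else 0

section UniformConvergence

variable {α : Type*} {N : ℕ}

/-- Exchange of the entries of two samples at the positions selected by `σ`. -/
def swapSamples (σ : Fin N → Bool) (z : (Fin N → α) × (Fin N → α)) :
    (Fin N → α) × (Fin N → α) :=
  (fun k => bif σ k then z.2 k else z.1 k, fun k => bif σ k then z.1 k else z.2 k)

lemma swapSamples_involutive (σ : Fin N → Bool) :
    Function.Involutive (swapSamples σ : (Fin N → α) × (Fin N → α) → _) := by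
  intro z
  ext k <;> simp only [swapSamples] <;> cases σ k <;> rfl

lemma sum_prod_weight [Fintype α] {q : α → ℝ} (hq1 : ∑ a, q a = 1) : ∑ x : Fin N → α, ∏ k, q (x k) = 1 := by
  have h := Finset.prod_univ_sum (fun _ : Fin N => (Finset.univ : Finset α)) (fun _ a => q a)
  rw [Fintype.piFinset_univ] at h
  simp [← h, hq1]

variable [DecidableEq α]

/-- The pooled sample ignores swaps, so the traces in `traceSum` stay fixed while averaging over
`σ`. -/
lemma image_swapSamples (σ : Fin N → Bool) (z : (Fin N → α) × (Fin N → α)) :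
    Finset.univ.image (swapSamples σ z).1 ∪ Finset.univ.image (swapSamples σ z).2 =
      Finset.univ.image z.1 ∪ Finset.univ.image z.2 := by
  ext a
  simp only [Finset.mem_union, Finset.mem_image, Finset.mem_univ, true_and, swapSamples,
    ← exists_or]
  refine exists_congr fun k => ?_
  cases σ k
  · rfl
  · exact or_comm

lemma abs_finInd_sub_le (T : Finset α) (a b : α) : |finInd T a - finInd T b| ≤ 1 := by
  unfold finInd
  split_ifs <;> norm_num

/-- The symmetrized exponential sum over the traces on two samples. -/
noncomputable def traceSum (𝓡 : Finset (Finset α)) (c : ℝ) (z : (Fin N → α) × (Fin N → α)) : ℝ :=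
  ∑ T ∈ traces 𝓡 (Finset.univ.image z.1 ∪ Finset.univ.image z.2),
    ∏ k, Real.exp (c * (finInd T (z.1 k) - finInd T (z.2 k)))

/-- The sum factors over the coordinates into terms `2 cosh (c * a k)`, and `cosh x ≤ exp (x² / 2)`.
-/
lemma sum_sign_prod_exp_le (c : ℝ) (a : Fin N → ℝ) (ha : ∀ k, |a k| ≤ 1) :
    ∑ σ : Fin N → Bool, ∏ k, Real.exp (c * (bif σ k then -a k else a k)) ≤
      2 ^ N * Real.exp (N * c ^ 2 / 2) := by
  have h := Finset.prod_univ_sum (fun _ : Fin N => (Finset.univ : Finset Bool))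
    (fun k b => Real.exp (c * (bif b then -a k else a k)))
  rw [Fintype.piFinset_univ] at h
  rw [← h]
  calc ∏ k, ∑ b : Bool, Real.exp (c * (bif b then -a k else a k))
      ≤ ∏ _k : Fin N, (2 * Real.exp (c ^ 2 / 2)) := by
        refine Finset.prod_le_prod (fun k _ => Finset.sum_nonneg fun b _ => (Real.exp_pos _).le)
          fun k _ => ?_
        have h1 := Real.cosh_le_exp_half_sq (c * a k)
        have h2 : Real.exp ((c * a k) ^ 2 / 2) ≤ Real.exp (c ^ 2 / 2) := by
          apply Real.exp_le_exp.mpr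
          have := (sq_le_one_iff_abs_le_one _).mpr (ha k)
          nlinarith [sq_nonneg c]
        rw [Real.cosh_eq] at h1
        simp only [Fintype.sum_bool, cond_true, cond_false, mul_neg]
        linarith
    _ = 2 ^ N * Real.exp (N * c ^ 2 / 2) := by
        rw [Finset.prod_const, Finset.card_univ, Fintype.card_fin, mul_pow, ← Real.exp_nat_mul]
        ring_nf

lemma sum_traceSum_swapSamples_le {𝓡 : Finset (Finset α)} {M : ℝ}
    (hM : ∀ Y : Finset α, Y.card ≤ 2 * N → ((traces 𝓡 Y).card : ℝ) ≤ M) (c : ℝ)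
    (z : (Fin N → α) × (Fin N → α)) :
    ∑ σ : Fin N → Bool, traceSum 𝓡 c (swapSamples σ z) ≤
      2 ^ N * (M * Real.exp (N * c ^ 2 / 2)) := by
  simp only [traceSum, image_swapSamples]
  rw [Finset.sum_comm]
  set Y := Finset.univ.image z.1 ∪ Finset.univ.image z.2
  have hY : Y.card ≤ 2 * N := by
    have h1 := Finset.card_image_le (s := Finset.univ) (f := z.1)
    have h2 := Finset.card_image_le (s := Finset.univ) (f := z.2)
    have h3 := Finset.card_union_le (Finset.univ.image z.1) (Finset.univ.image z.2)
    simp only [Finset.card_univ, Fintype.card_fin] at h1 h2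
    exact h3.trans (by omega)
  calc _ ≤ ∑ T ∈ traces 𝓡 Y, 2 ^ N * Real.exp (N * c ^ 2 / 2) := by
        refine Finset.sum_le_sum fun T _ => ?_
        refine le_trans (le_of_eq ?_)
          (sum_sign_prod_exp_le c (fun k => finInd T (z.1 k) - finInd T (z.2 k))
            fun k => abs_finInd_sub_le _ _ _)
        refine Finset.sum_congr rfl fun σ _ => Finset.prod_congr rfl fun k _ => ?_
        simp only [swapSamples]
        cases σ k <;> simp
    _ = (traces 𝓡 Y).card * (2 ^ N * Real.exp (N * c ^ 2 / 2)) := by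
        rw [Finset.sum_const, nsmul_eq_mul]
    _ ≤ M * (2 ^ N * Real.exp (N * c ^ 2 / 2)) :=
        mul_le_mul_of_nonneg_right (hM Y hY) (by positivity)
    _ = _ := by ring

/-- On the pooled sample `R` is indistinguishable from its trace, which contributes one of the
nonnegative summands. This replaces a union bound over all of `𝓡`. -/
lemma prod_exp_le_traceSum {𝓡 : Finset (Finset α)} {R : Finset α} (hR : R ∈ 𝓡) (c : ℝ)
    (z : (Fin N → α) × (Fin N → α)) :
    ∏ k, Real.exp (c * (finInd R (z.1 k) - finInd R (z.2 k))) ≤ traceSum 𝓡 c z := by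
  set Y := Finset.univ.image z.1 ∪ Finset.univ.image z.2 with hY
  have h : ∏ k, Real.exp (c * (finInd R (z.1 k) - finInd R (z.2 k))) =
      ∏ k, Real.exp (c * (finInd (Y ∩ R) (z.1 k) - finInd (Y ∩ R) (z.2 k))) := by
    refine Finset.prod_congr rfl fun k _ => ?_
    have h1 : z.1 k ∈ Y := by simp [hY]
    have h2 : z.2 k ∈ Y := by simp [hY]
    simp [finInd, h1, h2]
  rw [h]
  exact Finset.single_le_sum
    (f := fun T => ∏ k, Real.exp (c * (finInd T (z.1 k) - finInd T (z.2 k))))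
    (fun T _ => Finset.prod_nonneg fun _ _ => (Real.exp_pos _).le)
    (Finset.mem_image_of_mem _ hR)

variable [Fintype α] {q : α → ℝ}

/-- The product law of the two samples is invariant under every swap, so the expectation equals its
average over all `σ`, which is bounded pointwise. -/
lemma sum_traceSum_le (hq0 : ∀ a, 0 ≤ q a) (hq1 : ∑ a, q a = 1) {𝓡 : Finset (Finset α)} {M : ℝ}
    (hM : ∀ Y : Finset α, Y.card ≤ 2 * N → ((traces 𝓡 Y).card : ℝ) ≤ M) (c : ℝ) :
    ∑ x : Fin N → α, ∑ x' : Fin N → α, (∏ k, q (x k)) * (∏ k, q (x' k)) * traceSum 𝓡 c (x, x') ≤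
      M * Real.exp (N * c ^ 2 / 2) := by
  set W : (Fin N → α) × (Fin N → α) → ℝ := fun z => (∏ k, q (z.1 k)) * ∏ k, q (z.2 k) with hW
  have hW0 : ∀ z, 0 ≤ W z := fun z =>
    mul_nonneg (Finset.prod_nonneg fun _ _ => hq0 _) (Finset.prod_nonneg fun _ _ => hq0 _)
  have hW1 : ∑ z, W z = 1 := by
    rw [Fintype.sum_prod_type]
    simp [hW, ← Finset.mul_sum, sum_prod_weight hq1]
  have hWs : ∀ σ z, W (swapSamples σ z) = W z := by
    intro σ z
    simp only [hW, ← Finset.prod_mul_distrib, swapSamples]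
    refine Finset.prod_congr rfl fun k _ => ?_
    cases σ k <;> simp [mul_comm]
  have hS : ∀ σ : Fin N → Bool, ∑ z, W z * traceSum 𝓡 c (swapSamples σ z) =
      ∑ z, W z * traceSum 𝓡 c z := by
    intro σ
    rw [← Equiv.sum_comp (swapSamples_involutive (α := α) σ).toPerm fun z => W z * traceSum 𝓡 c z]
    exact Finset.sum_congr rfl fun z _ => by simp [hWs]
  have key : 2 ^ N * ∑ z, W z * traceSum 𝓡 c z ≤ 2 ^ N * (M * Real.exp (N * c ^ 2 / 2)) := by
    calc 2 ^ N * ∑ z, W z * traceSum 𝓡 c z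
        = ∑ σ : Fin N → Bool, ∑ z, W z * traceSum 𝓡 c (swapSamples σ z) := by
          rw [Finset.sum_congr rfl fun σ _ => hS σ]
          simp
      _ = ∑ z, W z * ∑ σ : Fin N → Bool, traceSum 𝓡 c (swapSamples σ z) := by
          rw [Finset.sum_comm]
          simp only [Finset.mul_sum]
      _ ≤ ∑ z, W z * (2 ^ N * (M * Real.exp (N * c ^ 2 / 2))) :=
          Finset.sum_le_sum fun z _ =>
            mul_le_mul_of_nonneg_left (sum_traceSum_swapSamples_le hM c z) (hW0 z)
      _ = _ := by rw [← Finset.sum_mul, hW1, one_mul]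
  have := le_of_mul_le_mul_left key (by positivity)
  rwa [Fintype.sum_prod_type] at this

/-- Jensen's inequality in each coordinate; it lets a ghost sample stand in for the true mean. -/
lemma exp_mean_le (hq0 : ∀ a, 0 ≤ q a) (hq1 : ∑ a, q a = 1) (c : ℝ) (T : Finset α) :
    Real.exp (c * (N * ∑ a, q a * finInd T a)) ≤
      ∑ x : Fin N → α, (∏ k, q (x k)) * ∏ k, Real.exp (c * finInd T (x k)) := by
  have h := Finset.prod_univ_sum (fun _ : Fin N => (Finset.univ : Finset α))
    (fun _ a => q a * Real.exp (c * finInd T a))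
  rw [Fintype.piFinset_univ] at h
  simp only [Finset.prod_mul_distrib] at h
  rw [← h, Finset.prod_const, Finset.card_univ, Fintype.card_fin]
  have hJ := convexOn_exp.map_sum_le (t := Finset.univ) (w := q) (p := fun a => c * finInd T a)
    (fun a _ => hq0 a) hq1 fun a _ => Set.mem_univ _
  simp only [smul_eq_mul] at hJ
  calc Real.exp (c * (N * ∑ a, q a * finInd T a))
      = Real.exp (∑ a, q a * (c * finInd T a)) ^ N := by
        rw [← Real.exp_nat_mul, ← mul_assoc, mul_comm c, mul_assoc, Finset.mul_sum]
        simp only [mul_left_comm]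
    _ ≤ _ := pow_le_pow_left₀ (Real.exp_pos _).le hJ N

/-- The exponential-moment form of the uniform law of large numbers: a sample that deviates
by `N * ε` on some member of `𝓡`, in the direction of the sign `η`, is unlikely. -/
lemma sum_weight_deviation_le (hq0 : ∀ a, 0 ≤ q a) (hq1 : ∑ a, q a = 1)
    {𝓡 : Finset (Finset α)} {M : ℝ}
    (hM : ∀ Y : Finset α, Y.card ≤ 2 * N → ((traces 𝓡 Y).card : ℝ) ≤ M) {ε : ℝ} (hε : 0 ≤ ε)
    {η : ℝ} (hη : η ^ 2 = 1) (bad : Finset (Fin N → α))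
    (hbad : ∀ x ∈ bad, ∃ R ∈ 𝓡,
      N * ε ≤ η * (∑ k, finInd R (x k) - N * ∑ a, q a * finInd R a)) :
    ∑ x ∈ bad, ∏ k, q (x k) ≤ M * Real.exp (-(N * ε ^ 2 / 2)) := by
  have hw : ∀ x : Fin N → α, 0 ≤ ∏ k, q (x k) := fun x => Finset.prod_nonneg fun _ _ => hq0 _
  have ht : ∀ z : (Fin N → α) × (Fin N → α), 0 ≤ traceSum 𝓡 (η * ε) z := fun z =>
    Finset.sum_nonneg fun T _ => Finset.prod_nonneg fun _ _ => (Real.exp_pos _).le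
  -- An exponential Markov inequality. The parameter `c = η * ε` maximizes `|c| * ε - c² / 2`: the
  -- deviation gains `N ε²` and symmetrization costs `N ε² / 2`.
  have hx : ∀ x ∈ bad, Real.exp (N * ε ^ 2) ≤
      ∑ x' : Fin N → α, (∏ k, q (x' k)) * traceSum 𝓡 (η * ε) (x, x') := by
    intro x hxb
    obtain ⟨R, hR, hdev⟩ := hbad x hxb
    calc Real.exp (N * ε ^ 2)
        ≤ Real.exp (η * ε * ∑ k, finInd R (x k)) *
            Real.exp (-(η * ε) * (N * ∑ a, q a * finInd R a)) := by
          rw [← Real.exp_add]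
          apply Real.exp_le_exp.mpr
          nlinarith [mul_le_mul_of_nonneg_left hdev hε]
      _ ≤ Real.exp (η * ε * ∑ k, finInd R (x k)) *
            ∑ x' : Fin N → α, (∏ k, q (x' k)) * ∏ k, Real.exp (-(η * ε) * finInd R (x' k)) :=
          mul_le_mul_of_nonneg_left (exp_mean_le hq0 hq1 _ R) (Real.exp_pos _).le
      _ = ∑ x' : Fin N → α, (∏ k, q (x' k)) *
            ∏ k, Real.exp (η * ε * (finInd R (x k) - finInd R (x' k))) := by
          rw [Finset.mul_sum, Finset.mul_sum, Real.exp_sum]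
          refine Finset.sum_congr rfl fun x' _ => ?_
          rw [mul_left_comm, ← Finset.prod_mul_distrib]
          congr 1
          refine Finset.prod_congr rfl fun k _ => ?_
          rw [← Real.exp_add]
          ring_nf
      _ ≤ _ := Finset.sum_le_sum fun x' _ =>
          mul_le_mul_of_nonneg_left (prod_exp_le_traceSum hR _ (x, x')) (hw x')
  have h1 : Real.exp (N * ε ^ 2) * ∑ x ∈ bad, ∏ k, q (x k) ≤ M * Real.exp (N * ε ^ 2 / 2) := by
    calc Real.exp (N * ε ^ 2) * ∑ x ∈ bad, ∏ k, q (x k)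
        ≤ ∑ x ∈ bad, (∏ k, q (x k)) *
            ∑ x' : Fin N → α, (∏ k, q (x' k)) * traceSum 𝓡 (η * ε) (x, x') := by
          rw [mul_comm, Finset.sum_mul]
          exact Finset.sum_le_sum fun x hxb => mul_le_mul_of_nonneg_left (hx x hxb) (hw x)
      _ ≤ ∑ x, (∏ k, q (x k)) *
            ∑ x' : Fin N → α, (∏ k, q (x' k)) * traceSum 𝓡 (η * ε) (x, x') :=
          Finset.sum_le_univ_sum_of_nonneg fun x =>
            mul_nonneg (hw x) (Finset.sum_nonneg fun x' _ => mul_nonneg (hw x') (ht _))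
      _ ≤ M * Real.exp (N * (η * ε) ^ 2 / 2) := by
          simpa only [Finset.mul_sum, mul_assoc] using sum_traceSum_le hq0 hq1 hM (η * ε)
      _ = _ := by rw [mul_pow, hη, one_mul]
  have h2 : M * Real.exp (N * ε ^ 2 / 2) =
      Real.exp (N * ε ^ 2) * (M * Real.exp (-(N * ε ^ 2 / 2))) := by
    rw [mul_left_comm, ← Real.exp_add]
    ring_nf
  rw [h2] at h1
  exact le_of_mul_le_mul_left h1 (Real.exp_pos _)

end UniformConvergence

/-! ### Trace counts for halfspaces and slabs -/

section Slabs

variable {α : Type*} [DecidableEq α] {d : ℕ}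

lemma subset_of_shatters_traces {𝓡 : Finset (Finset α)} {Y S : Finset α}
    (h : (traces 𝓡 Y).Shatters S) : S ⊆ Y := by
  obtain ⟨U, hU, hS⟩ := h (Finset.Subset.refl S)
  obtain ⟨R, -, rfl⟩ := Finset.mem_image.1 hU
  exact (Finset.inter_eq_left.1 hS).trans Finset.inter_subset_left

variable [Fintype α]

open Classical in
/-- The sets of indices of the points of the family `p` in a closed halfspace. -/
noncomputable def halfspaces (p : α → Pt d) : Finset (Finset α) :=
  Finset.univ.filter fun T => ∃ (u : Pt d) (b : ℝ), ∀ a, a ∈ T ↔ inner ℝ u (p a) ≤ b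

open Classical in
/-- The sets of indices of the points of the family `p` in a closed slab. -/
noncomputable def slabs (p : α → Pt d) : Finset (Finset α) :=
  Finset.univ.filter fun T => ∃ (u : Pt d) (b b' : ℝ),
    ∀ a, a ∈ T ↔ inner ℝ u (p a) ≤ b ∧ -inner ℝ u (p a) ≤ b'

/-- Sets shattered by halfspaces of `ℝ^d` have at most `d + 1` elements, by Radon's theorem. -/
lemma card_le_of_shatters_halfspaces (p : α → Pt d) {Y S : Finset α}
    (h : (traces (halfspaces p) Y).Shatters S) : S.card ≤ d + 1 := by
  classical
  by_contra hcard
  have hind : ¬ AffineIndependent ℝ (fun i : S => p i) := by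
    intro hi
    have h1 := hi.card_le_finrank_succ
    have h2 := Submodule.finrank_le (vectorSpan ℝ (Set.range fun i : S => p i))
    rw [finrank_euclideanSpace_fin] at h2
    rw [Fintype.card_coe] at h1
    omega
  obtain ⟨I, x, hxI, hxIc⟩ := Convex.radon_partition hind
  -- Shattering would let a halfspace separate the two Radon classes, although their hulls share
  -- `x`.
  obtain ⟨U, hU, hSU⟩ := h (t := S.filter fun a => ∃ ha : a ∈ S, (⟨a, ha⟩ : S) ∈ I)
    (Finset.filter_subset _ _)
  obtain ⟨H, hH, rfl⟩ := Finset.mem_image.1 hU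
  obtain ⟨u, b, hub⟩ := (Finset.mem_filter.1 hH).2
  have hmem : ∀ i : S, inner ℝ u (p i) ≤ b ↔ i ∈ I := by
    intro i
    have hi := congrArg (fun T => (i : α) ∈ T) hSU
    simp only [Finset.mem_inter, Finset.mem_filter, i.2, subset_of_shatters_traces h i.2,
      true_and, eq_iff_iff, Subtype.coe_eta, exists_prop_of_true] at hi
    rw [← hub, hi]
  have hlin : IsLinearMap ℝ fun y : Pt d => inner ℝ u y := (innerₛₗ ℝ u).isLinear
  have h1 : inner ℝ u x ≤ b := by
    refine convexHull_min ?_ (convex_halfSpace_le hlin b) hxI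
    rintro _ ⟨i, hi, rfl⟩
    exact (hmem i).2 hi
  have h2 : b < inner ℝ u x := by
    refine convexHull_min ?_ (convex_halfSpace_gt hlin b) hxIc
    rintro _ ⟨i, hi, rfl⟩
    exact not_le.1 fun hle => hi ((hmem i).1 hle)
  exact absurd h1 (not_le.2 h2)

/-- The Sauer–Shelah bound for the traces of halfspaces. -/
lemma card_traces_halfspaces_le (p : α → Pt d) (Y : Finset α) :
    (traces (halfspaces p) Y).card ≤ (Y.card + 1) ^ (d + 1) := by
  have hsub : (traces (halfspaces p) Y).shatterer ⊆
      (Finset.range (d + 1 + 1)).biUnion fun k => Y.powersetCard k := by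
    intro S hS
    rw [Finset.mem_shatterer] at hS
    simp only [Finset.mem_biUnion, Finset.mem_range, Finset.mem_powersetCard]
    exact ⟨S.card, Nat.lt_succ_of_le (card_le_of_shatters_halfspaces p hS),
      subset_of_shatters_traces hS, rfl⟩
  calc (traces (halfspaces p) Y).card ≤ _ := Finset.card_le_card_shatterer _
    _ ≤ _ := Finset.card_le_card hsub
    _ ≤ _ := Finset.card_biUnion_le
    -- The factor `(d + 1).choose k ≥ 1` is inserted to reach the binomial expansion of `(Y.card +
    -- 1) ^ (d + 1)`.
    _ ≤ ∑ k ∈ Finset.range (d + 1 + 1), Y.card ^ k * 1 ^ (d + 1 - k) * (d + 1).choose k := by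
        refine Finset.sum_le_sum fun k hk => ?_
        rw [Finset.card_powersetCard, one_pow, mul_one]
        exact (Nat.choose_le_pow _ _).trans (Nat.le_mul_of_pos_right _
          (Nat.choose_pos (Nat.lt_succ_iff.1 (Finset.mem_range.1 hk))))
    _ = _ := (add_pow _ _ _).symm

/-- A slab is the intersection of two halfspaces with normals `u` and `-u`. -/
lemma card_traces_slabs_le (p : α → Pt d) (Y : Finset α) :
    (traces (slabs p) Y).card ≤ ((Y.card + 1) ^ (d + 1)) ^ 2 := by
  classical
  have hsub : traces (slabs p) Y ⊆
      Finset.image₂ (· ∩ ·) (traces (halfspaces p) Y) (traces (halfspaces p) Y) := by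
    intro U hU
    obtain ⟨R, hR, rfl⟩ := Finset.mem_image.1 hU
    obtain ⟨u, b, b', hR⟩ := (Finset.mem_filter.1 hR).2
    have hmem : ∀ (v : Pt d) (c : ℝ),
        (Y ∩ Finset.univ.filter fun a => inner ℝ v (p a) ≤ c) ∈ traces (halfspaces p) Y :=
      fun v c => Finset.mem_image_of_mem _
        (Finset.mem_filter.2 ⟨Finset.mem_univ _, v, c, fun a => by simp⟩)
    refine Finset.mem_image₂.2 ⟨_, hmem u b, _, hmem (-u) b', ?_⟩
    ext a
    simp only [Finset.mem_inter, Finset.mem_filter, Finset.mem_univ, true_and, hR, inner_neg_left]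
    tauto
  calc _ ≤ _ := Finset.card_le_card hsub
    _ ≤ _ := Finset.card_image₂_le _ _ _
    _ ≤ _ := by
        rw [sq]
        exact Nat.mul_le_mul (card_traces_halfspaces_le p Y) (card_traces_halfspaces_le p Y)

/-- The failure probability of the uniform approximation of slabs by `N` samples. -/
lemma sum_weight_slab_deviation_le {q : α → ℝ} (hq0 : ∀ a, 0 ≤ q a) (hq1 : ∑ a, q a = 1)
    (p : α → Pt d) {N : ℕ} {ε : ℝ} (hε : 0 ≤ ε) (bad : Finset (Fin N → α))
    (hbad : ∀ x ∈ bad, ∃ R ∈ slabs p,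
      N * ε ≤ |∑ k, finInd R (x k) - N * ∑ a, q a * finInd R a|) :
    ∑ x ∈ bad, ∏ k, q (x k) ≤
      2 * (((2 * N + 1) ^ (d + 1)) ^ 2 * Real.exp (-(N * ε ^ 2 / 2))) := by
  classical
  have hM : ∀ Y : Finset α, Y.card ≤ 2 * N →
      ((traces (slabs p) Y).card : ℝ) ≤ ((2 * N + 1) ^ (d + 1)) ^ 2 := by
    intro Y hY
    have h : (traces (slabs p) Y).card ≤ ((2 * N + 1) ^ (d + 1)) ^ 2 :=
      (card_traces_slabs_le p Y).trans (by gcongr)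
    exact_mod_cast h
  -- Excess and deficit are treated separately, which gives the factor 2.
  have hside : ∀ η : ℝ, η ^ 2 = 1 → _ := fun η hη =>
    sum_weight_deviation_le hq0 hq1 hM hε hη
      (Finset.univ.filter fun x : Fin N → α => ∃ R ∈ slabs p,
        N * ε ≤ η * (∑ k, finInd R (x k) - N * ∑ a, q a * finInd R a))
      fun x hx => (Finset.mem_filter.1 hx).2
  have hw : ∀ x : Fin N → α, 0 ≤ ∏ k, q (x k) := fun x => Finset.prod_nonneg fun _ _ => hq0 _
  calc ∑ x ∈ bad, ∏ k, q (x k)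
      ≤ ∑ x ∈ (Finset.univ.filter fun x : Fin N → α => ∃ R ∈ slabs p,
            N * ε ≤ 1 * (∑ k, finInd R (x k) - N * ∑ a, q a * finInd R a)) ∪
          (Finset.univ.filter fun x : Fin N → α => ∃ R ∈ slabs p,
            N * ε ≤ (-1) * (∑ k, finInd R (x k) - N * ∑ a, q a * finInd R a)),
          ∏ k, q (x k) := by
        refine Finset.sum_le_sum_of_subset_of_nonneg (fun x hx => ?_) fun x _ _ => hw x
        obtain ⟨R, hR, hdev⟩ := hbad x hx
        rcases le_abs.1 hdev with h | h
        · exact Finset.mem_union_left _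
            (Finset.mem_filter.2 ⟨Finset.mem_univ _, R, hR, by linarith⟩)
        · exact Finset.mem_union_right _
            (Finset.mem_filter.2 ⟨Finset.mem_univ _, R, hR, by linarith⟩)
    _ ≤ _ := by
        have h := Finset.sum_union_inter (s₁ := Finset.univ.filter fun x : Fin N → α =>
            ∃ R ∈ slabs p, N * ε ≤ 1 * (∑ k, finInd R (x k) - N * ∑ a, q a * finInd R a))
          (s₂ := Finset.univ.filter fun x : Fin N → α => ∃ R ∈ slabs p,
            N * ε ≤ (-1) * (∑ k, finInd R (x k) - N * ∑ a, q a * finInd R a))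
          (f := fun x => ∏ k, q (x k))
        have h1 := hside 1 (by norm_num)
        have h2 := hside (-1) (by norm_num)
        have h3 := Finset.sum_nonneg (s := (Finset.univ.filter fun x : Fin N → α =>
            ∃ R ∈ slabs p, N * ε ≤ 1 * (∑ k, finInd R (x k) - N * ∑ a, q a * finInd R a)) ∩
          (Finset.univ.filter fun x : Fin N → α => ∃ R ∈ slabs p,
            N * ε ≤ (-1) * (∑ k, finInd R (x k) - N * ∑ a, q a * finInd R a)))
          fun x _ => hw x
        linarith

end Slabs

/-! ### Numerical estimate of the sample size -/

/-- With `y = √N`, the exponent to control is `1 + 4 D y - N ε² / 2`. The hypothesis gives both `4 L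
≤ N ε²` and `20 D y ≤ N ε²`, so half of the exponential pays for `1 + 4 D y ≤ 5 D y` and the other
half for `δ = exp (-L)`. -/
lemma failure_bound_le {D N : ℕ} (hD : 0 < D) {ε δ : ℝ} (hε0 : 0 < ε) (hε1 : ε ≤ 1) (hδ0 : 0 < δ)
    (hδ : δ ≤ 1 / 2) (hN : 800 * (D : ℝ) ^ 2 * Real.log (1 / δ) ≤ N * ε ^ 4) :
    2 * (((2 * N + 1) ^ D) ^ 2 * Real.exp (-(N * ε ^ 2 / 2))) ≤ δ := by
  set L := Real.log (1 / δ) with hL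
  have hL2 : 1 / 2 ≤ L := by
    have h1 : Real.log 2 ≤ L := Real.log_le_log (by norm_num) (by
      rw [le_div_iff₀ hδ0]; linarith)
    have := Real.log_two_gt_d9
    linarith
  have hD1 : (1 : ℝ) ≤ D := by exact_mod_cast hD
  have hD2 : (1 : ℝ) ≤ (D : ℝ) ^ 2 := one_le_pow₀ hD1
  have hε4 : ε ^ 4 ≤ ε ^ 2 := pow_le_pow_of_le_one hε0.le hε1 (by norm_num)
  have hDL : 400 * (D : ℝ) ^ 2 ≤ 800 * (D : ℝ) ^ 2 * L := by nlinarith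
  have hN0 : (0 : ℝ) < N := by
    by_contra h
    have : (N : ℝ) * ε ^ 4 ≤ 0 := mul_nonpos_of_nonpos_of_nonneg (not_lt.1 h) (by positivity)
    linarith
  have hN1 : (1 : ℝ) ≤ N := by exact_mod_cast (by exact_mod_cast hN0 : 0 < N)
  set y := Real.sqrt N with hy
  have hyy : y ^ 2 = N := Real.sq_sqrt hN0.le
  have hy1 : 1 ≤ y := by rw [hy]; exact Real.one_le_sqrt.2 hN1
  have hA : 4 * L ≤ N * ε ^ 2 := by
    have : (N : ℝ) * ε ^ 4 ≤ N * ε ^ 2 := mul_le_mul_of_nonneg_left hε4 hN0.le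
    nlinarith
  have hB : 20 * (D * y) ≤ N * ε ^ 2 := by
    refine le_of_sq_le_sq ?_ (by positivity)
    calc (20 * (D * y)) ^ 2 = N * (400 * (D : ℝ) ^ 2) := by rw [← hyy]; ring
      _ ≤ N * (N * ε ^ 4) := mul_le_mul_of_nonneg_left (hDL.trans hN) hN0.le
      _ = _ := by ring
  have hlog : Real.log (2 * N + 1) ≤ 2 * y := by
    have h1 : Real.log (2 * N + 1) ≤ Real.log (3 * y ^ 2) :=
      Real.log_le_log (by positivity) (by rw [hyy]; linarith)
    rw [Real.log_mul (by norm_num) (by positivity), Real.log_pow] at h1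
    have h2 := Real.log_le_sub_one_of_pos (show (0 : ℝ) < 3 by norm_num)
    have h3 := Real.log_le_sub_one_of_pos (show (0 : ℝ) < y by linarith)
    push_cast at h1
    linarith
  have hδL : δ = Real.exp (-L) := by
    rw [hL, one_div, Real.log_inv, neg_neg, Real.exp_log hδ0]
  have hpow : (((2 * N + 1 : ℝ)) ^ D) ^ 2 = Real.exp (2 * D * Real.log (2 * N + 1)) := by
    rw [← pow_mul, ← Real.exp_log (show (0 : ℝ) < 2 * N + 1 by positivity), ← Real.exp_nat_mul,
      Real.exp_log (by positivity)]
    push_cast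
    ring_nf
  rw [hpow, ← Real.exp_add, hδL]
  have h2e : (2 : ℝ) ≤ Real.exp 1 := by have := Real.add_one_le_exp (1 : ℝ); linarith
  calc _ ≤ Real.exp 1 * Real.exp (2 * D * Real.log (2 * N + 1) + -(N * ε ^ 2 / 2)) :=
        mul_le_mul_of_nonneg_right h2e (Real.exp_pos _).le
    _ ≤ _ := by
        rw [← Real.exp_add]
        apply Real.exp_le_exp.2
        have hDy : 1 ≤ D * y := by nlinarith
        have : 2 * D * Real.log (2 * N + 1) ≤ 2 * D * (2 * y) :=
          mul_le_mul_of_nonneg_left hlog (by positivity)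
        nlinarith

/-! ### Width distribution as an expectation over presence indicators -/

/-- The assumption `0 ≤ t` covers the empty set, whose width is `0`. -/
lemma dirWidth_le_iff {d : ℕ} (Q : Finset (Pt d)) (u : Pt d) {t : ℝ} (ht : 0 ≤ t) :
    dirWidth Q u ≤ t ↔ ∀ x ∈ Q, ∀ y ∈ Q, inner ℝ u x - inner ℝ u y ≤ t := by
  unfold dirWidth
  split_ifs with hQ
  · constructor
    · intro h x hx y hy
      have h1 := Finset.le_sup' (fun p => inner ℝ u p) hx
      have h2 := Finset.le_sup' (fun p => inner ℝ (-u) p) hy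
      simp only [inner_neg_left] at h2
      simp only [supportFn, inner_neg_left] at h
      linarith
    · intro h
      obtain ⟨x, hx, hx'⟩ := Finset.exists_mem_eq_sup' hQ fun p => inner ℝ u p
      obtain ⟨y, hy, hy'⟩ := Finset.exists_mem_eq_sup' hQ fun p => inner ℝ (-u) p
      rw [supportFn, supportFn, hx', hy', inner_neg_left]
      linarith [h x hx y hy]
  · simp [Finset.not_nonempty_iff_eq_empty.1 hQ, ht]

lemma measureReal_pi_eq_sum {ι α : Type*} [Fintype ι] [DecidableEq ι] [Fintype α]
    [MeasurableSpace α] [MeasurableSingletonClass α] (μ : ι → Measure α)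
    [∀ i, IsProbabilityMeasure (μ i)] (A : Set (ι → α)) [DecidablePred (· ∈ A)] :
    (Measure.pi μ).real A = ∑ x, (∏ i, (μ i).real {x i}) * (if x ∈ A then 1 else 0) := by
  classical
  have hA : A = ((Finset.univ.filter (· ∈ A) : Finset (ι → α)) : Set (ι → α)) := by
    ext; simp
  conv_lhs => rw [hA]
  rw [← sum_measureReal_singleton, Finset.sum_filter]
  refine Finset.sum_congr rfl fun x _ => ?_
  simp [measureReal_def, Measure.pi_singleton, ENNReal.toReal_prod]

open Classical in
/-- The indicator of the event that the present points among those with coordinates `x` lie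
within distance `t` of each other. -/
noncomputable def spreadInd {ι : Type*} (x : ι → ℝ) (t : ℝ) (b : ι → Bool) : ℝ :=
  if ∀ i j, b i = true → b j = true → x i - x j ≤ t then 1 else 0

namespace StochasticPoints

variable {d n : ℕ}

lemma widthCDF_eq_presenceExp (P : StochasticPoints d n) (hP : ∀ i, (P.prob i : ℝ) < 1)
    (u : Pt d) {t : ℝ} (ht : 0 ≤ t) :
    P.widthCDF u t = presenceExp P.rate (spreadInd (fun i => inner ℝ u (P.pos i)) t) := by
  classical
  rw [widthCDF, presenceLaw, measureReal_pi_eq_sum, presenceExp]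
  refine Finset.sum_congr rfl fun b _ => ?_
  congr 1
  · refine Finset.prod_congr rfl fun i _ => ?_
    have h : Real.exp (Real.log (1 - (P.prob i : ℝ))) = 1 - P.prob i :=
      Real.exp_log (by linarith [hP i])
    cases b i <;> simp [presenceWeight, rate, h]
  · simp only [spreadInd, Set.mem_ofPred_eq, dirWidth_le_iff _ u ht, realization]
    congr 1
    simp only [Finset.mem_image, Finset.mem_filter, Finset.mem_univ, true_and, eq_iff_iff]
    constructor
    · intro h i j hi hj
      exact h _ ⟨i, hi, rfl⟩ _ ⟨j, hj, rfl⟩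
    · rintro h _ ⟨i, hi, rfl⟩ _ ⟨j, hj, rfl⟩
      exact h i j hi hj

lemma coreset_rate (P : StochasticPoints d n) {N : ℕ} (sample : Fin N → Fin n) (k : Fin N) :
    (P.coreset sample).rate k = P.totalRate / N := by
  simp [rate, coreset]

end StochasticPoints

/-! ### Joint index set and the effect of adding one point -/

section Superposition

variable {ι κ : Type*}

lemma spreadInd_sumElim_false_right (x : ι → ℝ) (y : κ → ℝ) (t : ℝ) (b : ι → Bool) :
    spreadInd (Sum.elim x y) t (Sum.elim b fun _ => false) = spreadInd x t b := by
  unfold spreadInd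
  congr 1
  simp [Sum.forall]

lemma spreadInd_sumElim_false_left (x : ι → ℝ) (y : κ → ℝ) (t : ℝ) (b : κ → Bool) :
    spreadInd (Sum.elim x y) t (Sum.elim (fun _ => false) b) = spreadInd y t b := by
  unfold spreadInd
  congr 1
  simp [Sum.forall]

/-- Finitely many upper bounds amount to their minimum. If there are none, finiteness of `ι`
provides a bound above every `x i`. -/
lemma exists_forall_le_iff [Fintype ι] (x c : ι → ℝ) (s : Finset ι) :
    ∃ B, ∀ i, (∀ j ∈ s, x i ≤ c j) ↔ x i ≤ B := by
  rcases s.eq_empty_or_nonempty with rfl | hs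
  · exact ⟨∑ i, |x i|, fun i => by
      simpa using (le_abs_self _).trans
        (Finset.single_le_sum (f := fun i => |x i|) (fun i _ => abs_nonneg _) (Finset.mem_univ i))⟩
  · exact ⟨s.inf' hs c, fun i => (Finset.le_inf'_iff hs c).symm⟩

variable [Fintype ι] [DecidableEq ι] [Fintype κ] [DecidableEq κ]

/-- Points of rate zero are almost surely absent. -/
lemma presenceExp_sumElim_zero_right (r : ι → ℝ) (F : (ι ⊕ κ → Bool) → ℝ) :
    presenceExp (Sum.elim r fun _ => 0) F =
      presenceExp r fun b => F (Sum.elim b fun _ => false) := by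
  unfold presenceExp
  rw [← Equiv.sum_comp (Equiv.sumArrowEquivProdArrow ι κ Bool).symm, Fintype.sum_prod_type]
  refine Finset.sum_congr rfl fun b _ => ?_
  rw [Finset.sum_eq_single fun _ => false]
  · simp [Equiv.sumArrowEquivProdArrow, presenceWeight]
  · intro c _ hc
    obtain ⟨k, hk⟩ := Function.ne_iff.1 hc
    have : ∏ k, presenceWeight 0 (c k) = 0 :=
      Finset.prod_eq_zero (Finset.mem_univ k) (by simp_all [presenceWeight])
    simp [Equiv.sumArrowEquivProdArrow, this]
  · simp

lemma presenceExp_sumElim_zero_left (r : κ → ℝ) (F : (ι ⊕ κ → Bool) → ℝ) :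
    presenceExp (Sum.elim (fun _ => 0) r) F =
      presenceExp r fun b => F (Sum.elim (fun _ => false) b) := by
  unfold presenceExp
  rw [← Equiv.sum_comp (Equiv.sumArrowEquivProdArrow ι κ Bool).symm, Fintype.sum_prod_type_right]
  refine Finset.sum_congr rfl fun b _ => ?_
  rw [Finset.sum_eq_single fun _ => false]
  · simp [Equiv.sumArrowEquivProdArrow, presenceWeight]
  · intro c _ hc
    obtain ⟨k, hk⟩ := Function.ne_iff.1 hc
    have : ∏ k, presenceWeight 0 (c k) = 0 :=
      Finset.prod_eq_zero (Finset.mem_univ k) (by simp_all [presenceWeight])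
    simp [Equiv.sumArrowEquivProdArrow, this]
  · simp

lemma spreadInd_update_eq_zero {x : ι → ℝ} {t : ℝ} {b : ι → Bool}
    (hb : spreadInd x t b = 0) (i : ι) : spreadInd x t (Function.update b i true) = 0 := by
  have h : ¬ ∀ i j, b i = true → b j = true → x i - x j ≤ t := by
    simpa [spreadInd] using hb
  refine if_neg fun h' => h fun j k hj hk => h' j k ?_ ?_
  · by_cases e : j = i <;> simp [e, hj]
  · by_cases e : k = i <;> simp [e, hk]

/-- If the present points have small spread, then the additional points that keep it small are
those in a slab. -/
lemma exists_spreadInd_update_eq {x : ι → ℝ} {t : ℝ} (ht : 0 ≤ t) {b : ι → Bool}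
    (hb : spreadInd x t b ≠ 0) :
    ∃ B B', ∀ i, spreadInd x t (Function.update b i true) =
      if x i ≤ B ∧ -x i ≤ B' then 1 else 0 := by
  have h : ∀ i j, b i = true → b j = true → x i - x j ≤ t := by
    by_contra h
    exact hb (if_neg h)
  obtain ⟨B, hB⟩ := exists_forall_le_iff x (fun j => x j + t) (Finset.univ.filter (b · = true))
  obtain ⟨B', hB'⟩ :=
    exists_forall_le_iff (fun i => -x i) (fun j => -x j + t) (Finset.univ.filter (b · = true))
  refine ⟨B, B', fun i => ?_⟩
  unfold spreadInd
  congr 1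
  rw [← hB, ← hB', eq_iff_iff]
  simp only [Finset.mem_filter, Finset.mem_univ, true_and]
  constructor
  · intro h'
    refine ⟨fun j hj => ?_, fun j hj => ?_⟩
    · have := h' i j (by simp) (by by_cases e : j = i <;> simp [e, hj])
      linarith
    · have := h' j i (by by_cases e : j = i <;> simp [e, hj]) (by simp)
      linarith
  · rintro ⟨h1, h2⟩ j k hj hk
    by_cases ej : j = i <;> by_cases ek : k = i <;>
      simp only [Function.update_apply, ej, ek, if_true, if_false] at hj hk ⊢
    -- The added point is compared with itself, so `0 ≤ t` is needed.
    · simpa using ht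
    · linarith [h1 k hk]
    · linarith [h2 j hj]
    · exact h j k hj hk

end Superposition

/-! ### From slab approximation to width distributions; the sampling law -/

namespace StochasticPoints

variable {d n : ℕ}

/-- If the sample approximates every slab up to `ε`, then the coreset approximates the
distribution of the width up to `λ * ε`. -/
lemma abs_widthCDF_coreset_sub_le (P : StochasticPoints d n) (hP : ∀ i, (P.prob i : ℝ) < 1)
    (hr : 0 < P.totalRate) {N : ℕ} (hN : 0 < N) (sample : Fin N → Fin n) {ε : ℝ} (hε : 0 ≤ ε)
    (hs : ∀ R ∈ slabs P.pos, |∑ k, finInd R (sample k) -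
      N * ∑ i, P.rate i / P.totalRate * finInd R i| ≤ N * ε)
    (u : Pt d) {t : ℝ} (ht : 0 ≤ t) :
    |(P.coreset sample).widthCDF u t - P.widthCDF u t| ≤ P.totalRate * ε := by
  classical
  have hN' : (0 : ℝ) < N := by exact_mod_cast hN
  have hc : ∀ k, ((P.coreset sample).prob k : ℝ) < 1 := fun k =>
    sub_lt_self _ (Real.exp_pos _)
  set x : Fin n → ℝ := fun i => inner ℝ u (P.pos i) with hx
  set X : Fin n ⊕ Fin N → ℝ := Sum.elim x fun k => x (sample k) with hX
  -- The rates `r` describe `P` and `r + ρ` the coreset; along the way the original points fade out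
  -- while the samples fade in.
  set r : Fin n ⊕ Fin N → ℝ := Sum.elim P.rate fun _ => 0 with hrdef
  set ρ : Fin n ⊕ Fin N → ℝ := Sum.elim (fun i => -P.rate i) fun _ => P.totalRate / N with hρ
  have e0 : P.widthCDF u t = presenceExp r (spreadInd X t) := by
    rw [P.widthCDF_eq_presenceExp hP u ht, hrdef, presenceExp_sumElim_zero_right]
    simp only [hX, spreadInd_sumElim_false_right, hx]
  have e1 : (P.coreset sample).widthCDF u t =
      presenceExp (fun i => r i + ρ i) (spreadInd X t) := by
    have hrate : (P.coreset sample).rate = fun _ => P.totalRate / N :=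
      funext (P.coreset_rate sample)
    have hsum : (fun i => r i + ρ i) =
        Sum.elim (fun _ => 0) fun _ : Fin N => P.totalRate / N := by
      ext i; cases i <;> simp [hrdef, hρ]
    rw [(P.coreset sample).widthCDF_eq_presenceExp hc u ht, hrate, hsum,
      presenceExp_sumElim_zero_left]
    simp only [hX, spreadInd_sumElim_false_left, hx, coreset]
  have hq : 0 ≤ P.totalRate / N := by positivity
  rw [e0, e1]
  refine abs_presenceExp_sub_le r ρ ?_ ?_ _ fun b => ?_
  · rintro (i | k) <;> simp [hrdef, P.rate_nonneg]
  · rintro (i | k) <;> simp [hrdef, hρ, hq]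
  -- Both collections have total rate `λ`, so the term with `F b` drops out of the generator.
  have hρ0 : ∑ i, ρ i = 0 := by
    simp only [hρ, Fintype.sum_sum_type, Sum.elim_inl, Sum.elim_inr, Finset.sum_neg_distrib,
      Finset.sum_const, Finset.card_univ, Fintype.card_fin, nsmul_eq_mul]
    rw [mul_div_cancel₀ _ hN'.ne']
    simp [totalRate]
  have hbound : 0 ≤ P.totalRate * ε := by positivity
  simp only [mul_sub, Finset.sum_sub_distrib, ← Finset.sum_mul, hρ0, zero_mul, sub_zero]
  by_cases hb : spreadInd X t b = 0
  · simpa [spreadInd_update_eq_zero hb] using hbound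
  obtain ⟨B, B', hB⟩ := exists_spreadInd_update_eq ht hb
  set R : Finset (Fin n) := Finset.univ.filter fun i => x i ≤ B ∧ -x i ≤ B' with hR
  have hRs : R ∈ slabs P.pos :=
    Finset.mem_filter.2 ⟨Finset.mem_univ _, u, B, B', fun i => by simp [hR, hx]⟩
  have hval : ∑ i, ρ i * spreadInd X t (Function.update b i true) =
      P.totalRate / N * (∑ k, finInd R (sample k) -
        N * ∑ i, P.rate i / P.totalRate * finInd R i) := by
    have h1 : P.totalRate / N * (N * ∑ i, P.rate i / P.totalRate * finInd R i) =
        ∑ i, P.rate i * finInd R i := by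
      rw [← mul_assoc, div_mul_cancel₀ _ hN'.ne', Finset.mul_sum]
      refine Finset.sum_congr rfl fun i _ => ?_
      field_simp
    rw [mul_sub, h1, Finset.mul_sum, Fintype.sum_sum_type]
    simp only [hB]
    simp only [hX, hρ, Sum.elim_inl, Sum.elim_inr, finInd, hR, Finset.mem_filter,
      Finset.mem_univ, true_and, neg_mul, Finset.sum_neg_distrib]
    ring
  rw [hval, abs_mul, abs_of_nonneg hq]
  calc _ ≤ P.totalRate / N * (N * ε) := mul_le_mul_of_nonneg_left (hs R hRs) hq
    _ = _ := by field_simp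

lemma sum_rate_div (P : StochasticPoints d n) (hr : 0 < P.totalRate) :
    ∑ i, P.rate i / P.totalRate = 1 := by
  rw [← Finset.sum_div]
  exact div_self hr.ne'

lemma rateMeasure_singleton (P : StochasticPoints d n) (i : Fin n) :
    P.rateMeasure {i} = ENNReal.ofReal (P.rate i / P.totalRate) := by
  rw [rateMeasure, Measure.finsetSum_apply, Finset.sum_eq_single i]
  · simp
  · intro j _ hj
    simp [hj]
  · simp

lemma isProbabilityMeasure_rateMeasure (P : StochasticPoints d n) (hr : 0 < P.totalRate) :
    IsProbabilityMeasure P.rateMeasure := by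
  constructor
  rw [← Finset.coe_univ, ← sum_measure_singleton]
  simp only [rateMeasure_singleton]
  rw [← ENNReal.ofReal_sum_of_nonneg fun i _ => div_nonneg (P.rate_nonneg i) hr.le,
    P.sum_rate_div hr, ENNReal.ofReal_one]

lemma sampleLaw_real_eq_sum (P : StochasticPoints d n) (hr : 0 < P.totalRate) {N : ℕ}
    (A : Set (Fin N → Fin n)) [DecidablePred (· ∈ A)] :
    (P.sampleLaw N).real A =
      ∑ x ∈ Finset.univ.filter (· ∈ A), ∏ k, P.rate (x k) / P.totalRate := by
  have := P.isProbabilityMeasure_rateMeasure hr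
  rw [sampleLaw, measureReal_pi_eq_sum, Finset.sum_filter]
  refine Finset.sum_congr rfl fun x _ => ?_
  simp [measureReal_def, rateMeasure_singleton,
    ENNReal.toReal_ofReal (div_nonneg (P.rate_nonneg _) hr.le)]

end StochasticPoints

/-! ### Main theorem -/

open StochasticPoints in
theorem mainTheorem8 (d : ℕ) :
    ∃ C : ℝ, 0 < C ∧
      ∀ (n : ℕ) (P : StochasticPoints d n), 0 < n →
        (∀ i, 0 < (P.prob i : ℝ) ∧ (P.prob i : ℝ) < 1) →
        ∀ τ δ : ℝ, 0 < τ → τ ≤ 1 / 2 → 0 < δ → δ ≤ 1 / 2 →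
        ∀ N : ℕ, C * (P.totalRate ^ 4 / τ ^ 4) * Real.log (1 / δ) ≤ (N : ℝ) →
          ENNReal.ofReal (1 - δ) ≤
            P.sampleLaw N {sample | ∀ (u : Pt d) (t : ℝ), 0 ≤ t →
              |(P.coreset sample).widthCDF u t - P.widthCDF u t| ≤ τ} := by
  classical
  -- The constant of `failure_bound_le` with `D = d + 1`, the exponent in the trace bound for
  -- halfspaces.
  refine ⟨800 * ((d + 1 : ℕ) : ℝ) ^ 2, by positivity, ?_⟩
  intro n P hn hP τ δ hτ _ hδ hδ2 N hN
  have hrate : ∀ i, 0 < P.rate i := fun i =>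
    neg_pos.2 (Real.log_neg (by linarith [(hP i).2]) (by linarith [(hP i).1]))
  have hr : 0 < P.totalRate :=
    Finset.sum_pos (fun i _ => hrate i) ⟨⟨0, hn⟩, Finset.mem_univ _⟩
  have hL : 0 < Real.log (1 / δ) := Real.log_pos (by rw [lt_div_iff₀ hδ]; linarith)
  have hN0 : 0 < N := by
    have : (0 : ℝ) < N := lt_of_lt_of_le (by positivity) hN
    exact_mod_cast this
  have hN' : (0 : ℝ) < N := by exact_mod_cast hN0
  have hq0 : ∀ i, 0 ≤ P.rate i / P.totalRate := fun i => div_nonneg (P.rate_nonneg i) hr.le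
  have hq1 := P.sum_rate_div hr
  have := P.isProbabilityMeasure_rateMeasure hr
  have : IsProbabilityMeasure (P.sampleLaw N) := by unfold sampleLaw; infer_instance
  set ε := τ / P.totalRate with hε
  have hε0 : 0 < ε := by positivity
  have hετ : P.totalRate * ε = τ := by rw [hε]; field_simp
  set good : Set (Fin N → Fin n) := {sample | ∀ (u : Pt d) (t : ℝ), 0 ≤ t →
    |(P.coreset sample).widthCDF u t - P.widthCDF u t| ≤ τ} with hgood
  have hgood_of : ∀ sample, (∀ R ∈ slabs P.pos, |∑ k, finInd R (sample k) -
      N * ∑ i, P.rate i / P.totalRate * finInd R i| ≤ N * ε) → sample ∈ good := by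
    intro sample hs u t ht
    rw [← hετ]
    exact P.abs_widthCDF_coreset_sub_le (fun i => (hP i).2) hr hN0 sample hε0.le hs u ht
  have hbad : (P.sampleLaw N).real goodᶜ ≤ δ := by
    rw [P.sampleLaw_real_eq_sum hr]
    -- For `ε ≥ 1` no sample fails: the count and `N` times the mean both lie in `[0, N]`.
    rcases le_total ε 1 with hε1 | hε1
    · refine (sum_weight_slab_deviation_le hq0 hq1 P.pos hε0.le _ fun x hx => ?_).trans
        (failure_bound_le d.succ_pos hε0 hε1 hδ hδ2 ?_)
      · by_contra! h
        exact (Finset.mem_filter.1 hx).2 (hgood_of x fun R hR => (h R hR).le)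
      · have hε4 : ε ^ 4 = τ ^ 4 / P.totalRate ^ 4 := div_pow _ _ _
        rw [hε4]
        rw [mul_right_comm, ← mul_div_assoc, div_le_iff₀ (by positivity)] at hN
        rw [← mul_div_assoc, le_div_iff₀ (by positivity)]
        exact hN
    · have hempty : Finset.univ.filter (· ∈ goodᶜ) = ∅ := by
        refine Finset.filter_eq_empty_iff.2 fun x _ => not_not.2 (hgood_of x fun R _ => ?_)
        have h1 : ∀ a : Fin n, 0 ≤ finInd R a ∧ finInd R a ≤ 1 := fun a => by
          unfold finInd; split_ifs <;> norm_num
        have h2 : 0 ≤ ∑ k, finInd R (x k) := Finset.sum_nonneg fun k _ => (h1 _).1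
        have h3 : ∑ k, finInd R (x k) ≤ N := by
          simpa using Finset.sum_le_card_nsmul Finset.univ (fun k => finInd R (x k)) 1
            fun k _ => (h1 _).2
        have h4 : 0 ≤ ∑ i, P.rate i / P.totalRate * finInd R i :=
          Finset.sum_nonneg fun i _ => mul_nonneg (hq0 i) (h1 i).1
        have h5 : ∑ i, P.rate i / P.totalRate * finInd R i ≤ 1 := by
          rw [← hq1]
          exact Finset.sum_le_sum fun i _ => mul_le_of_le_one_right (hq0 i) (h1 i).2
        rw [abs_le]
        constructor <;> nlinarith
      rw [hempty, Finset.sum_empty]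
      exact hδ.le
  have hcompl := probReal_compl_eq_one_sub (μ := P.sampleLaw N) (s := good)
    (Set.toFinite _).measurableSet
  rw [← ofReal_measureReal]
  exact ENNReal.ofReal_le_ofReal (by linarith)
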